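/- Let $S$ be a finite set of points in the plane, each coloured red or blue, no two sharing an $x$-coordinate or a $y$-coordinate. Two points $p,q\in S$ see each other in $S$ if the axis-aligned box spanned by $p$ and $q$ contains no point of $S$ in its interior; a point $p \in S$ participates in $S$ if it is visible from a point of $S$ of the opposite colour. A comparison-based algorithm is given, for each length $n$ and each assignment of colours to the indices $1,\dots,n$, by a decision tree whose nodes compare the $x$-coordinates or the $y$-coordinates of the input points at two indices, report the point at an index, or halt. Its running time on an input sequence is the number of comparisons made plus the number of reports made. It is correct if on every sequence of coloured points, no two sharing an $x$- or a $y$-coordinate, it reports exactly the participating points. For an algorithm $A$ let $T_A(S)$ be the maximum running time of $A$ over all $|S|!$ orderings of $S$, and let $\mathrm{OPT}(S)$ be the minimum of $T_A(S)$ over all correct comparison-based algorithms $A$. Then $\mathrm{OPT}(S)\in\Omega(h\log n)$, where $n=|S|$ and $h$ is the number of points that participate in $S$. That is, there is an absolute constant $c>0$ such that $\mathrm{OPT}(S)\ge c\,h\log n$ for every such set $S$. -/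

import Mathlib

noncomputable section

namespace OrderOblivious

/-- The two colours. -/
inductive Color where
  | red
  | blue

/-- A point of the plane, coloured red or blue. -/
@[ext]
structure ColoredPoint where
  x : ℝ
  y : ℝ
  color : Color

/-- The two coordinate axes. -/
inductive Axis where
  | horizontal
  | vertical

/-- The coordinate of a point along an axis. -/
def ColoredPoint.coord (p : ColoredPoint) : Axis → ℝ
  | .horizontal => p.x
  | .vertical => p.y

/-- No two points of `S` share the same `x` coordinate or the same `y` coordinate. -/
def Nondegenerate (S : Set ColoredPoint) : Prop :=
  Set.InjOn ColoredPoint.x S ∧ Set.InjOn ColoredPoint.y S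

/-- `p` and `q` see each other in `S`: the interior of the axis-aligned box spanned by `p` and `q`
contains no point of `S`. -/
def Sees (S : Set ColoredPoint) (p q : ColoredPoint) : Prop :=
  ∀ r ∈ S, ¬ (r.x ∈ Set.uIoo p.x q.x ∧ r.y ∈ Set.uIoo p.y q.y)

/-- The points that participate in `S`: the points of `S` that are visible from a point of `S` of
the opposite colour. -/
def participating (S : Set ColoredPoint) : Set ColoredPoint :=
  {p ∈ S | ∃ q ∈ S, q.color ≠ p.color ∧ Sees S q p}

/-- Comparison-based decision trees on sequences of `n` points. A node either halts, or reports the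
point at index `i`, or compares the coordinates along one axis of the points at indices `i` and `j`
and branches on the answer. -/
inductive DecisionTree (n : ℕ) : Type where
  | halt : DecisionTree n
  | report (i : Fin n) (next : DecisionTree n) : DecisionTree n
  | compare (a : Axis) (i j : Fin n) (ifLe ifGt : DecisionTree n) : DecisionTree n

open Classical in
/-- The set of indices reported by the tree on the input sequence `s`. -/
def DecisionTree.output {n : ℕ} (s : Fin n → ColoredPoint) : DecisionTree n → Set (Fin n)
  | .halt => ∅
  | .report i next => insert i (next.output s)
  | .compare a i j ifLe ifGt =>
      if (s i).coord a ≤ (s j).coord a then ifLe.output s else ifGt.output s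

open Classical in
/-- The running time of the tree on the input sequence `s`: one unit for every comparison made and
one unit for every point reported. -/
def DecisionTree.time {n : ℕ} (s : Fin n → ColoredPoint) : DecisionTree n → ℕ
  | .halt => 0
  | .report _ next => next.time s + 1
  | .compare a i j ifLe ifGt =>
      (if (s i).coord a ≤ (s j).coord a then ifLe.time s else ifGt.time s) + 1

/-- A comparison-based algorithm: the length of the input and the colours of the indices are known
for free; the coordinates can be accessed through comparisons only. -/
def Algorithm : Type := (n : ℕ) → (Fin n → Color) → DecisionTree n

/-- The tree that the algorithm follows on the input sequence `s`. -/
def Algorithm.tree (A : Algorithm) {n : ℕ} (s : Fin n → ColoredPoint) : DecisionTree n :=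
  A n (fun i => (s i).color)

/-- The algorithm correctly solves the problem of reporting participating points: on every sequence
of points, no two sharing an `x` or a `y` coordinate, it reports exactly the indices of the
participating points. -/
def Algorithm.Correct (A : Algorithm) : Prop :=
  ∀ (n : ℕ) (s : Fin n → ColoredPoint),
    Function.Injective (fun i => (s i).x) → Function.Injective (fun i => (s i).y) →
      (A.tree s).output s = {i | s i ∈ participating (Set.range s)}

open Classical in
/-- `T_A(S)`: the maximum running time of `A` over all `n!` orderings of the set `S`. -/
def Algorithm.worstTime (A : Algorithm) (S : Finset ColoredPoint) : ℕ :=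
  Finset.univ.sup fun σ : Fin S.card ≃ {p // p ∈ S} =>
    (A.tree fun i => (σ i : ColoredPoint)).time fun i => (σ i : ColoredPoint)

/-- `OPT(S)`: the minimum of `T_A(S)` over all correct comparison-based algorithms `A`. -/
def OPT (S : Finset ColoredPoint) : ℕ :=
  sInf {t | ∃ A : Algorithm, A.Correct ∧ A.worstTime S = t}


/-- The outcomes of all comparisons of coordinates of a sequence. -/
def leData {n : ℕ} (s : Fin n → ColoredPoint) : Set (Axis × Fin n × Fin n) :=
  {q | (s q.2.1).coord q.1 ≤ (s q.2.2).coord q.1}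

theorem exists_output_eq_leData {n : ℕ} (F : Set (Axis × Fin n × Fin n) → Set (Fin n)) :
    ∃ T : DecisionTree n, ∀ s, T.output s = F (leData s) := by
  classical
  have rep : ∀ O : Finset (Fin n), ∃ T : DecisionTree n, ∀ s, T.output s = O := by
    intro O
    induction O using Finset.induction_on with
    | empty => exact ⟨.halt, fun s => by simp [DecisionTree.output]⟩
    | insert a O _ ih =>
      obtain ⟨T, hT⟩ := ih
      exact ⟨.report a T, fun s => by simp [DecisionTree.output, hT]⟩
  have key : ∀ (L : List (Axis × Fin n × Fin n)) (P : Set (Axis × Fin n × Fin n)),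
      ∃ T : DecisionTree n, ∀ s, (∀ q ∉ L, (q ∈ leData s ↔ q ∈ P)) →
        T.output s = F (leData s) := by
    intro L
    induction L with
    | nil =>
      intro P
      obtain ⟨T, hT⟩ := rep (F P).toFinite.toFinset
      refine ⟨T, fun s hs => ?_⟩
      have : leData s = P := Set.ext fun q => hs q (by simp)
      simp [hT, this]
    | cons a L ih =>
      intro P
      obtain ⟨T₁, h₁⟩ := ih (insert a P)
      obtain ⟨T₂, h₂⟩ := ih (P \ {a})
      refine ⟨.compare a.1 a.2.1 a.2.2 T₁ T₂, fun s hs => ?_⟩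
      by_cases h : (s a.2.1).coord a.1 ≤ (s a.2.2).coord a.1
      · simp only [DecisionTree.output, h, if_true]
        refine h₁ s fun q hq => ?_
        by_cases hqa : q = a
        · subst hqa; simpa [leData] using h
        · simp [hs q (by simp [hqa, hq]), hqa]
      · simp only [DecisionTree.output, h, if_false]
        refine h₂ s fun q hq => ?_
        by_cases hqa : q = a
        · subst hqa; simpa [leData] using h
        · simp [hs q (by simp [hqa, hq]), hqa]
  have e : Finite Axis := Finite.of_surjective
    (fun b : Bool => if b then Axis.horizontal else Axis.vertical)
    (fun a => by cases a; exacts [⟨true, by simp⟩, ⟨false, by simp⟩])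
  obtain ⟨L, hL⟩ : ∃ L : List (Axis × Fin n × Fin n), ∀ q, q ∈ L := by
    have := Fintype.ofFinite (Axis × Fin n × Fin n)
    exact ⟨Finset.univ.toList, by simp⟩
  obtain ⟨T, hT⟩ := key L ∅
  exact ⟨T, fun s => hT s fun q hq => absurd (hL q) hq⟩

theorem mem_participating_iff {n : ℕ} (s : Fin n → ColoredPoint) (i : Fin n) :
    s i ∈ participating (Set.range s) ↔ ∃ j, (s j).color ≠ (s i).color ∧ ∀ k,
      ¬ ((s k).x ∈ Set.uIoo (s j).x (s i).x ∧ (s k).y ∈ Set.uIoo (s j).y (s i).y) := by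
  simp [participating, Sees]

theorem participating_eq_of_leData_eq {n : ℕ} {s t : Fin n → ColoredPoint}
    (hc : ∀ i, (s i).color = (t i).color) (h : leData s = leData t) :
    {i | s i ∈ participating (Set.range s)} = {i | t i ∈ participating (Set.range t)} := by
  have hx : ∀ i j, (s i).x ≤ (s j).x ↔ (t i).x ≤ (t j).x := fun i j => by
    simpa [leData, ColoredPoint.coord] using Set.ext_iff.1 h (.horizontal, i, j)
  have hy : ∀ i j, (s i).y ≤ (s j).y ↔ (t i).y ≤ (t j).y := fun i j => by
    simpa [leData, ColoredPoint.coord] using Set.ext_iff.1 h (.vertical, i, j)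
  ext i
  simp only [Set.mem_ofPred_eq, mem_participating_iff, hc, Set.uIoo, Set.mem_Ioo, ← not_le,
    le_inf_iff, sup_le_iff, hx, hy]

/-- Correct comparison-based algorithms exist. -/
theorem exists_correct : ∃ A : Algorithm, A.Correct := by
  classical
  have : ∀ (n : ℕ) (c : Fin n → Color), ∃ T : DecisionTree n, ∀ s : Fin n → ColoredPoint,
      (fun i => (s i).color) = c → T.output s = {i | s i ∈ participating (Set.range s)} := by
    intro n c
    obtain ⟨T, hT⟩ := exists_output_eq_leData (n := n) fun P =>
      {i | ∃ t : Fin n → ColoredPoint, (fun i => (t i).color) = c ∧ leData t = P ∧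
        t i ∈ participating (Set.range t)}
    refine ⟨T, fun s hs => (hT s).trans ?_⟩
    ext i
    constructor
    · rintro ⟨t, ht, hl, hi⟩
      have := participating_eq_of_leData_eq (s := t) (t := s)
        (fun i => congrFun (ht.trans hs.symm) i) hl
      exact (Set.ext_iff.1 this i).1 hi
    · intro hi
      exact ⟨s, hs, rfl, hi⟩
  choose A hA using this
  exact ⟨A, fun n s _ _ => hA n _ s rfl⟩

/-- The minimum in the definition of `OPT` is attained by some correct algorithm. -/
theorem exists_correct_worstTime_eq_OPT (S : Finset ColoredPoint) :
    ∃ A : Algorithm, A.Correct ∧ A.worstTime S = OPT S := by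
  obtain ⟨A, hA⟩ := exists_correct
  exact Nat.sInf_mem (s := {t | ∃ A : Algorithm, A.Correct ∧ A.worstTime S = t})
    ⟨_, A, hA, rfl⟩

end OrderOblivious

end

/-! This is an adversary argument combined with counting. The comparisons made on an input reveal a
partial order on the indices along each axis, and any placement extending both orders gets the same
output. Suppose five indices of one colour are pairwise incomparable in both orders. Each axis can
then be extended so that the five are contiguous, with one at the centre and one in each quadrant
around it. Every point of the other colour lies outside this cluster in both coordinates, so its box
to the centre is blocked. Hence such a five-element set contains no reported index
(`card_antichain_le`).

Two bounds on the worst time `t` follow. First, the never-compared indices of one colour are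
pairwise incomparable, so at most four per colour can exist and `n = O(t)` (`le_time`). Second, let
`m` participating points have one colour. Of their `m!` rearrangements, at least `m! / 2 ^ t` follow
a common path. Along that path common antichains have at most four elements, so the `m` indices
split into `k ≤ 4√m` chains, each a chain of one of the two orders. A rearrangement is determined by
the chain from which each point is taken, so `m! ≤ 2 ^ t * k ^ m` and `m log m = O(t)`
(`factorial_le`).

If `n ≤ m ^ 2`, the second bound gives `m log n = O(t)`; otherwise the first does. Adding the two
colours finishes the proof. -/

namespace OrderOblivious

/-! ### Decision trees: paths and the partial orders they reveal -/

/-- The comparisons made by the tree on the input `s`, each recorded as `(a, i, j)` where the point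
at `i` does not exceed the point at `j` along the axis `a`. -/
noncomputable def DecisionTree.path {n : ℕ} (s : Fin n → ColoredPoint) :
    DecisionTree n → List (Axis × Fin n × Fin n)
  | .halt => []
  | .report _ next => next.path s
  | .compare a i j ifLe ifGt =>
      open Classical in
      if (s i).coord a ≤ (s j).coord a then (a, i, j) :: ifLe.path s else (a, j, i) :: ifGt.path s

namespace DecisionTree

variable {n : ℕ}

theorem length_path_le_time (s : Fin n → ColoredPoint) (T : DecisionTree n) :
    (T.path s).length ≤ T.time s := by
  induction T with
  | halt => simp [path, time]
  | report i next ih => simp only [path, time]; omega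
  | compare a i j l g hl hg =>
    simp only [path, time]
    split_ifs <;> simp only [List.length_cons] <;> omega

theorem ncard_output_le_time (s : Fin n → ColoredPoint) (T : DecisionTree n) :
    (T.output s).ncard ≤ T.time s := by
  induction T with
  | halt => simp [output, time]
  | report i next ih =>
    simp only [output, time]
    exact (Set.ncard_insert_le _ _).trans (by omega)
  | compare a i j l g hl hg =>
    simp only [output, time]
    split_ifs <;> omega

theorem coord_le_of_mem_path {s : Fin n → ColoredPoint} {T : DecisionTree n} {a : Axis}
    {i j : Fin n} (h : (a, i, j) ∈ T.path s) : (s i).coord a ≤ (s j).coord a := by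
  induction T with
  | halt => simp [path] at h
  | report k next ih => exact ih h
  | compare b k m l g hl hg =>
    simp only [path] at h
    split_ifs at h with hc
    · rcases List.mem_cons.1 h with h | h
      · obtain ⟨rfl, rfl, rfl⟩ := by simpa using h
        exact hc
      · exact hl h
    · rcases List.mem_cons.1 h with h | h
      · obtain ⟨rfl, rfl, rfl⟩ := by simpa using h
        exact (not_le.1 hc).le
      · exact hg h

/-- An input that respects all comparisons made on `s` leads to the same output as `s`. -/
theorem output_eq_of_path {s s' : Fin n → ColoredPoint} {T : DecisionTree n}
    (h : ∀ a i j, (a, i, j) ∈ T.path s → i ≠ j → (s' i).coord a < (s' j).coord a) :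
    T.output s' = T.output s := by
  induction T with
  | halt => rfl
  | report k next ih => simp only [output]; rw [ih h]
  | compare b k m l g hl hg =>
    simp only [path] at h
    simp only [output]
    by_cases hc : (s k).coord b ≤ (s m).coord b
    · simp only [hc, if_true] at h ⊢
      have : (s' k).coord b ≤ (s' m).coord b := by
        -- A tree may compare an index with itself; every input answers `≤` there, so this puts no
        -- constraint on `s'`.
        by_cases hkm : k = m
        · rw [hkm]
        · exact (h b k m (by simp) hkm).le
      rw [if_pos this, hl fun a i j hm => h a i j (List.mem_cons_of_mem _ hm)]
    · simp only [hc, if_false] at h ⊢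
      have : ¬ (s' k).coord b ≤ (s' m).coord b := by
        refine not_le.2 (h b m k (by simp) ?_)
        rintro rfl
        exact hc le_rfl
      rw [if_neg this, hg fun a i j hm => h a i j (List.mem_cons_of_mem _ hm)]

/-- Among inputs of running time at most `t`, a fraction of at least `2 ^ (-t)` shares a path. -/
theorem exists_common_path {α : Type*} (f : α → Fin n → ColoredPoint) (T : DecisionTree n) :
    ∀ (t : ℕ) (F : Finset α), F.Nonempty → (∀ x ∈ F, T.time (f x) ≤ t) →
      ∃ F' ⊆ F, F'.Nonempty ∧ F.card ≤ 2 ^ t * F'.card ∧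
        ∀ x ∈ F', ∀ y ∈ F', T.path (f x) = T.path (f y) := by
  classical
  induction T with
  | halt =>
    intro t F hF _
    exact ⟨F, subset_rfl, hF, Nat.le_mul_of_pos_left _ (by positivity), fun _ _ _ _ => rfl⟩
  | report i next ih =>
    intro t F hF h
    exact ih t F hF fun x hx => (Nat.le_succ _).trans (h x hx)
  | compare a i j l g hl hg =>
    intro t F hF h
    obtain ⟨x₀, hx₀⟩ := hF
    obtain ⟨t, rfl⟩ : ∃ u, t = u + 1 := by
      have := h x₀ hx₀
      simp only [time] at this
      exact ⟨t - 1, by omega⟩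
    have hcard := Finset.card_filter_add_card_filter_not (s := F)
      (fun x => (f x i).coord a ≤ (f x j).coord a)
    have hpos : 0 < F.card := Finset.card_pos.2 ⟨x₀, hx₀⟩
    -- Follow the branch taken by at least half of the inputs; each comparison costs one factor of
    -- 2.
    rcases le_total (F.filter fun x => ¬ (f x i).coord a ≤ (f x j).coord a).card
      (F.filter fun x => (f x i).coord a ≤ (f x j).coord a).card with hle | hle
    · obtain ⟨F', hs, hne, hc, hp⟩ := hl t (F.filter fun x => (f x i).coord a ≤ (f x j).coord a) (Finset.card_pos.1 (by omega)) (fun x hx => by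
        obtain ⟨hx, hxc⟩ := Finset.mem_filter.1 hx
        have := h x hx
        simp only [time, hxc, if_true] at this
        omega)
      refine ⟨F', hs.trans (Finset.filter_subset _ _), hne, by rw [pow_succ]; nlinarith, ?_⟩
      intro x hx y hy
      simp only [path, (Finset.mem_filter.1 (hs hx)).2, (Finset.mem_filter.1 (hs hy)).2, if_true,
        hp x hx y hy]
    · obtain ⟨F', hs, hne, hc, hp⟩ := hg t (F.filter fun x => ¬ (f x i).coord a ≤ (f x j).coord a) (Finset.card_pos.1 (by omega)) (fun x hx => by
        obtain ⟨hx, hxc⟩ := Finset.mem_filter.1 hx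
        have := h x hx
        simp only [time, hxc, if_false] at this
        omega)
      refine ⟨F', hs.trans (Finset.filter_subset _ _), hne, by rw [pow_succ]; nlinarith, ?_⟩
      intro x hx y hy
      simp only [path, (Finset.mem_filter.1 (hs hx)).2, (Finset.mem_filter.1 (hs hy)).2, if_false,
        hp x hx y hy]

/-- The order along the axis `a` that follows from the comparisons made on the input `s`. -/
def Below (T : DecisionTree n) (s : Fin n → ColoredPoint) (a : Axis) : Fin n → Fin n → Prop :=
  Relation.TransGen fun i j => i ≠ j ∧ (a, i, j) ∈ T.path s

theorem Below.trans {T : DecisionTree n} {s : Fin n → ColoredPoint} {a : Axis} {i j k : Fin n}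
    (h : T.Below s a i j) (h' : T.Below s a j k) : T.Below s a i k :=
  Relation.TransGen.trans h h'

theorem Below.coord_lt {T : DecisionTree n} {s : Fin n → ColoredPoint} {a : Axis}
    (hs : Function.Injective fun i => (s i).coord a) {i j : Fin n} (h : T.Below s a i j) :
    (s i).coord a < (s j).coord a := by
  induction h with
  | single h => exact (coord_le_of_mem_path h.2).lt_of_ne fun e => h.1 (hs e)
  | tail _ h ih => exact ih.trans ((coord_le_of_mem_path h.2).lt_of_ne fun e => h.1 (hs e))

/-- The adversary principle: the tree cannot tell `s` from any input that extends the revealed order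
on each axis. -/
theorem output_eq_of_below {s s' : Fin n → ColoredPoint} {T : DecisionTree n}
    (h : ∀ a i j, T.Below s a i j → (s' i).coord a < (s' j).coord a) :
    T.output s' = T.output s :=
  output_eq_of_path fun a i j hm hij => h a i j (.single ⟨hij, hm⟩)

end DecisionTree

/-! ### The adversary: clustering an antichain -/

/-- An antichain of a partial order can be made contiguous, in any order, by a linear extension. -/
theorem exists_cluster {ι κ : Type*} [Finite ι] {R : ι → ι → Prop}
    (htrans : ∀ i j k, R i j → R j k → R i k) {v : ι → ℝ} (hv : Function.Injective v)
    (hR : ∀ i j, R i j → v i < v j) {e : κ → ι} (he : ∀ k l, ¬ R (e k) (e l))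
    (hinj : Function.Injective e)
    {w : κ → ℝ} (hw : Function.Injective w) {b : ℝ} (hb : ∀ k, |w k| ≤ b) :
    ∃ v' : ι → ℝ, Function.Injective v' ∧ (∀ i j, R i j → v' i < v' j) ∧ (∀ k, v' (e k) = w k) ∧
      ∀ i, i ∉ Set.range e → b < |v' i| := by
  classical
  obtain ⟨M, hM⟩ : ∃ M, ∀ i, |v i| ≤ M := by
    obtain ⟨M, hM⟩ := (Set.finite_range fun i => |v i|).bddAbove
    exact ⟨M, fun i => hM ⟨i, rfl⟩⟩
  -- Elements below some member of the antichain are shifted under `-b`, all others above `b`. This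
  -- respects `R`: `D` is closed downwards, and an element of `D` above a member would, by
  -- transitivity, make two members comparable.
  let D : ι → Prop := fun i => ∃ k, R i (e k)
  let v' : ι → ℝ := fun i => if h : ∃ k, e k = i then w h.choose else
    if D i then v i - (M + |b| + 1) else v i + (M + |b| + 1)
  have h1 : ∀ k, v' (e k) = w k := fun k => by
    have h : ∃ l, e l = e k := ⟨k, rfl⟩
    simp only [v', dif_pos h]
    rw [hinj h.choose_spec]
  have h2 : ∀ i, i ∉ Set.range e → D i → v' i = v i - (M + |b| + 1) := fun i hi hd => by
    simp only [v', dif_neg (show ¬ ∃ k, e k = i from hi), if_pos hd]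
  have h3 : ∀ i, i ∉ Set.range e → ¬ D i → v' i = v i + (M + |b| + 1) := fun i hi hd => by
    simp only [v', dif_neg (show ¬ ∃ k, e k = i from hi), if_neg hd]
  have hb' := le_abs_self b
  have hMi : ∀ i, -M ≤ v i ∧ v i ≤ M := fun i => abs_le.1 (hM i)
  have hwb : ∀ k, -b ≤ w k ∧ w k ≤ b := fun k => abs_le.1 (hb k)
  have cases : ∀ i, (∃ k, e k = i) ∨ (i ∉ Set.range e ∧ D i) ∨ (i ∉ Set.range e ∧ ¬ D i) := by
    intro i
    by_cases h : ∃ k, e k = i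
    · exact .inl h
    · by_cases hd : D i
      · exact .inr (.inl ⟨h, hd⟩)
      · exact .inr (.inr ⟨h, hd⟩)
  refine ⟨v', ?_, ?_, h1, ?_⟩
  · intro i j hij
    rcases cases i with ⟨k, rfl⟩ | ⟨hi, di⟩ | ⟨hi, di⟩ <;>
    rcases cases j with ⟨l, rfl⟩ | ⟨hj, dj⟩ | ⟨hj, dj⟩
    · rw [h1, h1] at hij
      rw [hw hij]
    · rw [h1, h2 j hj dj] at hij
      linarith [hMi j, hwb k]
    · rw [h1, h3 j hj dj] at hij
      linarith [hMi j, hwb k]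
    · rw [h1, h2 i hi di] at hij
      linarith [hMi i, hwb l]
    · rw [h2 i hi di, h2 j hj dj] at hij
      exact hv (by linarith)
    · rw [h2 i hi di, h3 j hj dj] at hij
      linarith [hMi i, hMi j, abs_nonneg b]
    · rw [h1, h3 i hi di] at hij
      linarith [hMi i, hwb l]
    · rw [h3 i hi di, h2 j hj dj] at hij
      linarith [hMi i, hMi j, abs_nonneg b]
    · rw [h3 i hi di, h3 j hj dj] at hij
      exact hv (by linarith)
  · intro i j hij
    have := hR i j hij
    rcases cases i with ⟨k, rfl⟩ | ⟨hi, di⟩ | ⟨hi, di⟩ <;>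
    rcases cases j with ⟨l, rfl⟩ | ⟨hj, dj⟩ | ⟨hj, dj⟩
    · exact absurd hij (he k l)
    · obtain ⟨l, hl⟩ := dj
      exact absurd (htrans _ _ _ hij hl) (he k l)
    · rw [h1, h3 j hj dj]
      linarith [hMi j, hwb k]
    · rw [h1, h2 i hi di]
      linarith [hMi i, hwb l]
    · rw [h2 i hi di, h2 j hj dj]
      linarith
    · rw [h2 i hi di, h3 j hj dj]
      linarith [hMi i, hMi j, abs_nonneg b]
    · exact absurd ⟨l, hij⟩ di
    · obtain ⟨l, hl⟩ := dj
      exact absurd ⟨l, htrans _ _ _ hij hl⟩ di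
    · rw [h3 i hi di, h3 j hj dj]
      linarith
  · intro i hi
    by_cases di : D i
    · rw [h2 i hi di]
      refine lt_of_lt_of_le ?_ (neg_le_abs _)
      linarith [hMi i]
    · rw [h3 i hi di]
      refine lt_of_lt_of_le ?_ (le_abs_self _)
      linarith [hMi i]

/-- A point that is surrounded by four nearby points of its colour does not participate. -/
theorem not_mem_participating_of_cluster {n : ℕ} {s : Fin n → ColoredPoint} {e : Fin 5 → Fin n}
    (hc : ∀ k, (s (e k)).color = (s (e 0)).color)
    (hx : ∀ k, (s (e k)).x = ![0, 1, 2, -1, -2] k) (hy : ∀ k, (s (e k)).y = ![0, 1, -1, 2, -2] k)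
    (hfx : ∀ i ∉ Set.range e, 2 < |(s i).x|) (hfy : ∀ i ∉ Set.range e, 2 < |(s i).y|) :
    s (e 0) ∉ participating (Set.range s) := by
  rw [mem_participating_iff]
  rintro ⟨j, hj, hk⟩
  have hje : j ∉ Set.range e := by
    rintro ⟨k, rfl⟩
    exact hj (hc k)
  have h0x : (s (e 0)).x = 0 := hx 0
  have h0y : (s (e 0)).y = 0 := hy 0
  have mem : ∀ {a b : ℝ}, (0 < a ∧ a < b) ∨ (b < a ∧ a < 0) → a ∈ Set.uIoo b 0 := by
    rintro a b (h | h)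
    · rw [Set.uIoo_of_gt (h.1.trans h.2)]
      exact h
    · rw [Set.uIoo_of_lt (h.1.trans h.2)]
      exact h
  simp only [h0x, h0y] at hk
  -- The point at `j` lies strictly inside one quadrant, beyond the cluster in both coordinates, so
  -- the cluster point of that quadrant is inside the box.
  rcases lt_abs.1 (hfx j hje) with h | h <;> rcases lt_abs.1 (hfy j hje) with h' | h'
  · refine hk (e 1) ⟨mem (.inl ?_), mem (.inl ?_)⟩
    · rw [hx]; exact ⟨by simp, by simp; linarith⟩
    · rw [hy]; exact ⟨by simp, by simp; linarith⟩
  · refine hk (e 2) ⟨mem (.inl ?_), mem (.inr ?_)⟩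
    · rw [hx]; exact ⟨by simp, by simp; linarith⟩
    · rw [hy]; exact ⟨by simp; linarith, by simp⟩
  · refine hk (e 3) ⟨mem (.inr ?_), mem (.inl ?_)⟩
    · rw [hx]; exact ⟨by simp; linarith, by simp⟩
    · rw [hy]; exact ⟨by simp, by simp; linarith⟩
  · refine hk (e 4) ⟨mem (.inr ?_), mem (.inr ?_)⟩
    · rw [hx]; exact ⟨by simp; linarith, by simp⟩
    · rw [hy]; exact ⟨by simp; linarith, by simp⟩

/-! ### Chains and antichains of two orders -/

/-- A finite partially ordered set with a chain of maximum size `c` has a strictly monotone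
labelling by `0, …, c - 1`. -/
theorem exists_height {ι : Type*} {R : ι → ι → Prop} (htrans : ∀ i j k, R i j → R j k → R i k)
    (hirr : ∀ i, ¬ R i i) (U : Finset ι) {c : ℕ}
    (hc : ∀ C ⊆ U, IsChain R (C : Set ι) → C.card ≤ c) :
    ∃ f : ι → ℕ, (∀ i ∈ U, f i < c) ∧ ∀ i ∈ U, ∀ j ∈ U, R i j → f i < f j := by
  classical
  -- The label of `i` is the size of a longest chain in `U` strictly below `i`; adding `i` lengthens
  -- that chain by one.
  let P : ι → Finset (Finset ι) := fun i =>
    U.powerset.filter fun C => IsChain R (C : Set ι) ∧ ∀ x ∈ C, R x i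
  have hP : ∀ i C, C ∈ P i ↔ C ⊆ U ∧ IsChain R (C : Set ι) ∧ ∀ x ∈ C, R x i := fun i C => by
    simp [P]
  have ex : ∀ i, ∃ C ∈ P i, (P i).sup Finset.card = C.card := fun i =>
    Finset.exists_mem_eq_sup _ ⟨∅, by simp [hP]⟩ _
  have ins : ∀ i ∈ U, ∀ C ∈ P i, insert i C ⊆ U ∧ IsChain R (insert i C : Set ι) ∧
      (insert i C).card = C.card + 1 := by
    intro i hi C hC
    obtain ⟨h1, h2, h3⟩ := (hP i C).1 hC
    refine ⟨Finset.insert_subset hi h1, h2.insert fun b hb _ => .inr (h3 b hb), ?_⟩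
    exact Finset.card_insert_of_notMem fun h => hirr i (h3 i h)
  refine ⟨fun i => (P i).sup Finset.card, fun i hi => ?_, fun i hi j hj hij => ?_⟩
  · obtain ⟨C, hC, h⟩ := ex i
    obtain ⟨h1, h2, h3⟩ := ins i hi C hC
    have := hc _ h1 (by simpa using h2)
    show (P i).sup Finset.card < c
    omega
  · obtain ⟨C, hC, h⟩ := ex i
    obtain ⟨h1, h2, h3⟩ := ins i hi C hC
    have : insert i C ∈ P j := (hP _ _).2 ⟨h1, by simpa using h2, fun x hx => by
      rcases Finset.mem_insert.1 hx with rfl | hx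
      · exact hij
      · exact htrans _ _ _ (((hP _ _).1 hC).2.2 x hx) hij⟩
    have := Finset.le_sup (f := Finset.card) this
    show (P i).sup Finset.card < (P j).sup Finset.card
    omega

/-- A set that contains no large common antichain of two partial orders contains a chain of one of
them whose size is at least proportional to the square root of the size of the set. -/
theorem exists_chain_sqrt {ι : Type*} {R₁ R₂ : ι → ι → Prop}
    (ht₁ : ∀ i j k, R₁ i j → R₁ j k → R₁ i k) (ht₂ : ∀ i j k, R₂ i j → R₂ j k → R₂ i k)
    (hi₁ : ∀ i, ¬ R₁ i i) (hi₂ : ∀ i, ¬ R₂ i i) (U : Finset ι)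
    (hU : ∀ B ⊆ U, (∀ i ∈ B, ∀ j ∈ B, ¬ R₁ i j ∧ ¬ R₂ i j) → B.card ≤ 4) :
    ∃ C ⊆ U, (IsChain R₁ (C : Set ι) ∨ IsChain R₂ (C : Set ι)) ∧ U.card ≤ 4 * C.card ^ 2 := by
  classical
  let P : Finset (Finset ι) := U.powerset.filter fun C => IsChain R₁ (C : Set ι) ∨ IsChain R₂ (C : Set ι)
  obtain ⟨C, hC, hmax⟩ := P.exists_max_image (fun C => C.card) ⟨∅, by simp [P]⟩
  simp only [P, Finset.mem_filter, Finset.mem_powerset] at hC hmax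
  obtain ⟨f, hf, hf'⟩ := exists_height ht₁ hi₁ U (c := C.card)
    fun D hD h => hmax D ⟨hD, .inl h⟩
  obtain ⟨g, hg, hg'⟩ := exists_height ht₂ hi₂ U (c := C.card)
    fun D hD h => hmax D ⟨hD, .inr h⟩
  refine ⟨C, hC.1, hC.2, ?_⟩
  -- Indices with equal heights in both orders are incomparable in both, so each of the `C.card ^ 2`
  -- height pairs occurs at most four times.
  have := Finset.card_le_mul_card_image_of_maps_to (s := U)
    (t := Finset.range C.card ×ˢ Finset.range C.card) (f := fun i => (f i, g i))
    (fun i hi => by simp [hf i hi, hg i hi]) 4 (fun b _ => by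
      refine hU _ (Finset.filter_subset _ _) fun i hi j hj => ?_
      obtain ⟨hi, hib⟩ := Finset.mem_filter.1 hi
      obtain ⟨hj, hjb⟩ := Finset.mem_filter.1 hj
      have hij := hib.trans hjb.symm
      simp only [Prod.mk.injEq] at hij
      exact ⟨fun h => (hf' i hi j hj h).ne hij.1, fun h => (hg' i hi j hj h).ne hij.2⟩)
  simpa [sq] using this

/-- A set of size `m` that contains no large common antichain of two partial orders splits into at
most `4 √m` chains, each of them a chain of one of the two orders. -/
theorem exists_chain_partition {ι : Type*} {R₁ R₂ : ι → ι → Prop}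
    (ht₁ : ∀ i j k, R₁ i j → R₁ j k → R₁ i k) (ht₂ : ∀ i j k, R₂ i j → R₂ j k → R₂ i k)
    (hi₁ : ∀ i, ¬ R₁ i i) (hi₂ : ∀ i, ¬ R₂ i i) (U : Finset ι)
    (hU : ∀ B ⊆ U, (∀ i ∈ B, ∀ j ∈ B, ¬ R₁ i j ∧ ¬ R₂ i j) → B.card ≤ 4) :
    ∃ (k : ℕ) (g : ι → ℕ), (k : ℝ) ≤ 4 * √(U.card : ℝ) ∧ (∀ i ∈ U, g i < k) ∧
      ∀ c, IsChain R₁ {i | i ∈ U ∧ g i = c} ∨ IsChain R₂ {i | i ∈ U ∧ g i = c} := by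
  classical
  induction U using Finset.strongInduction with
  | H U ih =>
    rcases U.eq_empty_or_nonempty with rfl | hne
    · exact ⟨0, fun _ => 0, by simp, by simp, fun c => by simp⟩
    obtain ⟨C, hCU, hC, hcard⟩ := exists_chain_sqrt ht₁ ht₂ hi₁ hi₂ U hU
    have hUpos := hne.card_pos
    have hCpos : 0 < C.card := by
      rcases Nat.eq_zero_or_pos C.card with h | h
      · simp [h] at hcard; simp [hcard] at hUpos
      · exact h
    have hss : U \ C ⊂ U := Finset.sdiff_ssubset hCU (Finset.card_pos.1 hCpos)
    obtain ⟨k, g, hk, hg, hch⟩ := ih (U \ C) hss fun B hB => hU B (hB.trans Finset.sdiff_subset)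
    refine ⟨k + 1, fun i => if i ∈ C then k else g i, ?_, ?_, ?_⟩
    · have hsum : ((U \ C).card : ℝ) + C.card = U.card := by
        exact_mod_cast Finset.card_sdiff_add_card_eq_card hCU
      have hcard' : (U.card : ℝ) ≤ 4 * (C.card : ℝ) ^ 2 := by exact_mod_cast hcard
      have hs1 := Real.sq_sqrt (Nat.cast_nonneg (α := ℝ) U.card)
      have hs2 := Real.sq_sqrt (Nat.cast_nonneg (α := ℝ) (U \ C).card)
      have h1 : √(U.card : ℝ) ≤ 2 * C.card := Real.sqrt_le_iff.2 ⟨by positivity, by nlinarith⟩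
      have h2 := Real.sqrt_nonneg ((U \ C).card : ℝ)
      have h3 : 0 < √(U.card : ℝ) := Real.sqrt_pos.2 (by exact_mod_cast hUpos)
      push_cast
      -- Removing a chain of size at least `√|U| / 2` lowers `√|U|` by at least 1/4, which pays for
      -- one chain in the bound `4√|U|`.
      have h4 : √((U \ C).card : ℝ) ≤ √(U.card : ℝ) - 1 / 4 := by
        by_contra! hcon
        have h5 : 1 / 2 ≤ √(U.card : ℝ) := by
          have : (1 : ℝ) ≤ U.card := by exact_mod_cast hUpos
          exact Real.le_sqrt_of_sq_le (by norm_num; linarith)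
        nlinarith
      linarith
    · intro i hi
      by_cases hiC : i ∈ C
      · simp [hiC]
      · simp only [hiC, if_false]
        exact (hg i (by simp [hi, hiC])).trans (Nat.lt_succ_self k)
    · intro c
      by_cases hck : c = k
      · have hsub : {i | i ∈ U ∧ (if i ∈ C then k else g i) = c} ⊆ (C : Set ι) := by
          rintro i ⟨hi, h⟩
          by_contra hiC
          have hiC : i ∉ C := hiC
          rw [if_neg hiC] at h
          have := hg i (by simp [hi, hiC])
          omega
        exact hC.imp (fun h => h.mono hsub) (fun h => h.mono hsub)
      · have hsub : {i | i ∈ U ∧ (if i ∈ C then k else g i) = c} ⊆ {i | i ∈ U \ C ∧ g i = c} := by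
          rintro i ⟨hi, h⟩
          by_cases hiC : i ∈ C
          · rw [if_pos hiC] at h
            exact absurd h.symm hck
          · rw [if_neg hiC] at h
            exact ⟨by simp [hi, hiC], h⟩
        exact (hch c).imp (fun h => h.mono hsub) (fun h => h.mono hsub)

/-! ### Counting permutations monotone for both orders -/

/-- Two monotone enumerations of the same set of reals by a chain agree. -/
theorem eqOn_of_isChain {ι : Type*} [Finite ι] {R : ι → ι → Prop} {C : Set ι} (hC : IsChain R C)
    {f g : ι → ℝ} (hf : ∀ i j, R i j → f i < f j) (hg : ∀ i j, R i j → g i < g j)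
    (h : f '' C = g '' C) : Set.EqOn f g C := by
  -- The rank of `f i` within the image is the number of predecessors of `i` in the chain, which
  -- does not depend on `f`.
  have key : ∀ {f : ι → ℝ}, (∀ i j, R i j → f i < f j) → ∀ i ∈ C,
      {y ∈ f '' C | y < f i}.ncard = {c ∈ C | R c i}.ncard := by
    intro f hf i hi
    have hinj : Set.InjOn f C := by
      intro x hx y hy hxy
      by_contra hne
      rcases hC hx hy hne with h | h
      · exact (hf _ _ h).ne hxy
      · exact (hf _ _ h).ne' hxy
    have : {y ∈ f '' C | y < f i} = f '' {c ∈ C | R c i} := by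
      ext y
      constructor
      · rintro ⟨⟨c, hc, rfl⟩, hlt⟩
        refine ⟨c, ⟨hc, ?_⟩, rfl⟩
        have hne : c ≠ i := by rintro rfl; exact lt_irrefl _ hlt
        exact (hC hc hi hne).resolve_right fun h => lt_asymm hlt (hf _ _ h)
      · rintro ⟨c, ⟨hc, hci⟩, rfl⟩
        exact ⟨⟨c, hc, rfl⟩, hf _ _ hci⟩
    rw [this, (hinj.mono fun x hx => hx.1).ncard_image]
  have lt : ∀ {V : Set ℝ}, V.Finite → ∀ {a b : ℝ}, a ∈ V → a < b →
      {y ∈ V | y < a}.ncard < {y ∈ V | y < b}.ncard := by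
    intro V hV a b ha hab
    refine Set.ncard_lt_ncard ⟨fun y hy => ⟨hy.1, hy.2.trans hab⟩, fun hsub => ?_⟩
      (hV.subset fun y hy => hy.1)
    exact lt_irrefl a (hsub ⟨ha, hab⟩).2
  intro i hi
  have e : {y ∈ f '' C | y < f i}.ncard = {y ∈ f '' C | y < g i}.ncard := by
    rw [key hf i hi, h, key hg i hi]
  have hfin : (f '' C).Finite := C.toFinite.image f
  rcases lt_trichotomy (f i) (g i) with hlt | heq | hlt
  · exact absurd e (lt hfin ⟨i, hi, rfl⟩ hlt).ne
  · exact heq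
  · exact absurd e (lt hfin (h ▸ ⟨i, hi, rfl⟩) hlt).ne'

/-- If a set splits into `k` chains of two partial orders, then it has at most `k ^ m` bijections
to a given point set that are monotone for both orders. -/
theorem card_perm_le_pow {ι : Type*} [Fintype ι] [DecidableEq ι] {R₁ R₂ : ι → ι → Prop}
    {v₁ v₂ : ι → ℝ} (hv₁ : Function.Injective v₁) (hv₂ : Function.Injective v₂)
    {k : ℕ} (g : ι → Fin k) (hg : ∀ c, IsChain R₁ {i | g i = c} ∨ IsChain R₂ {i | g i = c})
    (F : Finset (Equiv.Perm ι)) (hF₁ : ∀ π ∈ F, ∀ i j, R₁ i j → v₁ (π i) < v₁ (π j))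
    (hF₂ : ∀ π ∈ F, ∀ i j, R₂ i j → v₂ (π i) < v₂ (π j)) :
    F.card ≤ k ^ Fintype.card ι := by
  have : F.card ≤ (Finset.univ : Finset (ι → Fin k)).card := by
    -- Encode `π` by the chain that each target is filled from. Equal codes give every chain the
    -- same image, and monotonicity then determines the permutation on the chain.
    refine Finset.card_le_card_of_injOn (fun π i => g (π.symm i)) (fun _ _ => by simp) ?_
    intro π hπ ρ hρ h
    have himg : ∀ c, π '' {i | g i = c} = ρ '' {i | g i = c} := by
      intro c
      ext x
      have := congrFun h x
      simp only [Equiv.image_eq_preimage_symm, Set.mem_preimage, Set.mem_ofPred_eq] at this ⊢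
      rw [this]
    ext i
    rcases hg (g i) with hc | hc
    · refine hv₁ (eqOn_of_isChain hc (f := v₁ ∘ π) (g := v₁ ∘ ρ) (hF₁ π hπ) (hF₁ ρ hρ) ?_ rfl)
      rw [Set.image_comp, himg, Set.image_comp]
    · refine hv₂ (eqOn_of_isChain hc (f := v₂ ∘ π) (g := v₂ ∘ ρ) (hF₂ π hπ) (hF₂ ρ hρ) ?_ rfl)
      rw [Set.image_comp, himg, Set.image_comp]
  simpa using this

/-! ### Two lower bounds for a correct tree -/

/-- Inputs on which an algorithm has to be correct. -/
def Generic {n : ℕ} (s : Fin n → ColoredPoint) : Prop :=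
  ∀ a, Function.Injective fun i => (s i).coord a

/-- The tree reports the participating points of all generic sequences coloured by `c`. -/
def DecisionTree.CorrectFor {n : ℕ} (T : DecisionTree n) (c : Fin n → Color) : Prop :=
  ∀ s : Fin n → ColoredPoint, Generic s → (∀ i, (s i).color = c i) →
    T.output s = {i | s i ∈ participating (Set.range s)}

/-- Indices of one colour that have not been compared, even indirectly, along either axis cannot be
reported if there are five of them. -/
theorem DecisionTree.CorrectFor.card_antichain_le {n : ℕ} {T : DecisionTree n} {c : Fin n → Color}
    (hT : T.CorrectFor c) {s : Fin n → ColoredPoint} (hs : Generic s)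
    {B : Finset (Fin n)} {j : Fin n} (hj : j ∈ B) (hjo : j ∈ T.output s)
    (hc : ∀ i ∈ B, c i = c j)
    (hB : ∀ a, ∀ i ∈ B, ∀ k ∈ B, ¬ T.Below s a i k) : B.card ≤ 4 := by
  by_contra! hcard
  obtain ⟨B', hB', hB'4⟩ := Finset.exists_subset_card_eq
    (show 4 ≤ (B.erase j).card by rw [Finset.card_erase_of_mem hj]; omega)
  let e : Fin 5 → Fin n := Fin.cons j (B'.orderEmbOfFin hB'4)
  have heB : ∀ k, e k ∈ B := by
    intro k
    refine Fin.cases hj (fun l => ?_) k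
    exact Finset.mem_of_mem_erase (hB' (B'.orderEmbOfFin_mem hB'4 l))
  have hinj : Function.Injective e := by
    refine Fin.cons_injective_iff.2 ⟨?_, (B'.orderEmbOfFin hB'4).injective⟩
    rintro ⟨l, hl⟩
    exact Finset.ne_of_mem_erase (hB' (B'.orderEmbOfFin_mem hB'4 l)) hl
  have place : ∀ a (w : Fin 5 → ℝ), Function.Injective w → (∀ k, |w k| ≤ 2) → _ :=
    fun a w hw hb => exists_cluster (R := T.Below s a) (fun _ _ _ h h' => h.trans h') (hs a)
      (fun _ _ h => h.coord_lt (hs a)) (e := e) (fun k l => hB a _ (heB k) _ (heB l)) hinj hw hb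
  -- The five positions are (0,0), (1,1), (2,-1), (-1,2), (-2,-2): the reported index at the centre,
  -- one point per quadrant, all coordinates distinct on each axis.
  obtain ⟨x, hxi, hxR, hxe, hxf⟩ := place .horizontal ![0, 1, 2, -1, -2]
    (by intro k l; fin_cases k <;> fin_cases l <;> norm_num)
    (by intro k; fin_cases k <;> norm_num)
  obtain ⟨y, hyi, hyR, hye, hyf⟩ := place .vertical ![0, 1, -1, 2, -2]
    (by intro k l; fin_cases k <;> fin_cases l <;> norm_num)
    (by intro k; fin_cases k <;> norm_num)
  let s' : Fin n → ColoredPoint := fun i => ⟨x i, y i, c i⟩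
  have hs' : Generic s' := fun a => by cases a; exacts [hxi, hyi]
  have hout : T.output s' = T.output s :=
    DecisionTree.output_eq_of_below fun a => by cases a; exacts [hxR, hyR]
  rw [← hout, hT s' hs' fun _ => rfl] at hjo
  exact not_mem_participating_of_cluster (s := s') (e := e)
    (fun k => (hc _ (heB k)).trans (hc _ (heB 0)).symm) hxe hye hxf hyf hjo

/-- A generic input with a participating point of each colour forces an algorithm to look at almost
all points. -/
theorem DecisionTree.CorrectFor.le_time {n : ℕ} {T : DecisionTree n} {c : Fin n → Color}
    (hT : T.CorrectFor c) {s : Fin n → ColoredPoint} (hs : Generic s)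
    (hp : ∀ κ, ∃ j ∈ T.output s, c j = κ) : n ≤ 2 * T.time s + 8 := by
  classical
  let touched : Finset (Fin n) :=
    ((T.path s).map fun q => q.2.1).toFinset ∪ ((T.path s).map fun q => q.2.2).toFinset
  have htouched : touched.card ≤ 2 * T.time s := by
    have h1 := List.toFinset_card_le ((T.path s).map fun q => q.2.1)
    have h2 := List.toFinset_card_le ((T.path s).map fun q => q.2.2)
    have h3 := Finset.card_union_le ((T.path s).map fun q => q.2.1).toFinset
      ((T.path s).map fun q => q.2.2).toFinset
    have h4 := T.length_path_le_time s
    simp only [List.length_map] at h1 h2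
    show (_ ∪ _ : Finset (Fin n)).card ≤ _
    omega
  have hl : ∀ {a i k}, T.Below s a i k → i ∈ touched ∧ k ∈ touched := by
    intro a i k h
    have step : ∀ {i k}, (a, i, k) ∈ T.path s → i ∈ touched ∧ k ∈ touched := by
      intro i k hm
      simp only [touched, Finset.mem_union, List.mem_toFinset, List.mem_map]
      exact ⟨.inl ⟨_, hm, rfl⟩, .inr ⟨_, hm, rfl⟩⟩
    induction h with
    | single h => exact step h.2
    | tail _ h ih => exact ⟨ih.1, (step h.2).2⟩
  have hle : ∀ κ, (touchedᶜ.filter fun i => c i = κ).card ≤ 4 := by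
    intro κ
    obtain ⟨j, hj, hjκ⟩ := hp κ
    -- The antichain bound needs a reported member, so `j` is added even if it was compared: a
    -- relation needs two distinct compared indices, and `j` is the only possible one here.
    refine (Finset.card_le_card (Finset.subset_insert j _)).trans
      (hT.card_antichain_le hs (Finset.mem_insert_self j _) hj ?_ ?_)
    · intro i hi
      rcases Finset.mem_insert.1 hi with rfl | hi
      · rfl
      · rw [(Finset.mem_filter.1 hi).2, hjκ]
    · intro a i hi k hk h
      have hun : ∀ l ∈ touched, l ∈ insert j (touchedᶜ.filter fun i => c i = κ) → l = j := by
        intro l hl hm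
        refine (Finset.mem_insert.1 hm).resolve_right fun hm => ?_
        exact Finset.mem_compl.1 (Finset.mem_filter.1 hm).1 hl
      have h1 := hun i (hl h).1 hi
      have h2 := hun k (hl h).2 hk
      subst h1
      subst h2
      exact lt_irrefl _ (h.coord_lt (hs a))
  have hsplit : touchedᶜ ⊆ (touchedᶜ.filter fun i => c i = .red) ∪
      (touchedᶜ.filter fun i => c i = .blue) := by
    intro i hi
    rcases hci : c i with _ | _ <;> simp only [Finset.mem_union, Finset.mem_filter, hi, hci] <;> simp
  have h1 := (Finset.card_le_card hsplit).trans (Finset.card_union_le _ _)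
  have h2 := hle .red
  have h3 := hle .blue
  have h4 := Finset.card_compl touched
  simp only [Fintype.card_fin] at h4
  omega

/-- Permuting the participating points of one colour produces too many different inputs for a
shallow decision tree. -/
theorem DecisionTree.CorrectFor.factorial_le {n : ℕ} {T : DecisionTree n} {c : Fin n → Color}
    (hT : T.CorrectFor c) {s : Fin n → ColoredPoint} (hs : Generic s)
    (hsc : ∀ i, (s i).color = c i) {κ : Color} (I : Finset (Fin n))
    (hI : ∀ i ∈ I, i ∈ T.output s ∧ c i = κ) {t : ℕ}
    (ht : ∀ σ : Equiv.Perm (Fin n), (∀ i, (s (σ i)).color = c i) → T.time (s ∘ σ) ≤ t) :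
    ∃ k : ℕ, (k : ℝ) ≤ 4 * √(I.card : ℝ) ∧ I.card.factorial ≤ 2 ^ t * k ^ I.card := by
  classical
  -- Extended by the identity, a permutation of the monochromatic set `I` preserves the colouring,
  -- so the same tree is followed.
  let E : Equiv.Perm I → Equiv.Perm (Fin n) := fun π => Equiv.Perm.ofSubtype (p := (· ∈ I)) π
  have hEI : ∀ π (i : I), E π i = π i := fun π i => Equiv.Perm.ofSubtype_apply_coe π i
  have hEc : ∀ π i, (s (E π i)).color = c i := by
    intro π i
    by_cases hi : i ∈ I
    · have := hEI π ⟨i, hi⟩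
      simp only at this
      rw [this, hsc, (hI _ (π ⟨i, hi⟩).2).2, (hI i hi).2]
    · have : E π i = i := Equiv.Perm.ofSubtype_apply_of_not_mem π hi
      rw [this, hsc]
  have hgen : ∀ π, Generic (s ∘ E π) := fun π a => (hs a).comp (E π).injective
  obtain ⟨F, -, ⟨π₀, hπ₀⟩, hcard, hpath⟩ := T.exists_common_path (fun π => s ∘ E π) t
    Finset.univ Finset.univ_nonempty fun π _ => ht _ (hEc π)
  let R : Axis → I → I → Prop := fun a i j => T.Below (s ∘ E π₀) a i j
  have hR : ∀ π ∈ F, ∀ a i j, R a i j → (s (π i)).coord a < (s (π j)).coord a := by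
    intro π hπ a i j h
    have h : T.Below (s ∘ E π) a i j := by
      simp only [R, DecisionTree.Below] at h ⊢
      rwa [hpath π hπ π₀ hπ₀]
    simpa [hEI] using h.coord_lt (hgen π a)
  have hirr : ∀ a i, ¬ R a i i := fun a i h => lt_irrefl _ (hR π₀ hπ₀ a i i h)
  -- The set of points is unchanged, and each index of `I` still receives a participating point.
  have hrep : ∀ i ∈ I, i ∈ T.output (s ∘ E π₀) := by
    intro i hi
    rw [hT _ (hgen π₀) (hEc π₀)]
    have h1 := (hI _ (π₀ ⟨i, hi⟩).2).1
    rw [hT s hs hsc] at h1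
    have := hEI π₀ ⟨i, hi⟩
    simp only at this
    simpa [Set.range_comp, this] using h1
  obtain ⟨k, g, hk, hg, hch⟩ := exists_chain_partition (R₁ := R .horizontal) (R₂ := R .vertical)
    (fun _ _ _ h h' => h.trans h') (fun _ _ _ h h' => h.trans h') (hirr _) (hirr _) Finset.univ
    (by
      intro B _ hB
      rcases B.eq_empty_or_nonempty with rfl | ⟨j, hj⟩
      · simp
      rw [← Finset.card_map (Function.Embedding.subtype _)]
      refine hT.card_antichain_le (hgen π₀) (j := j) (Finset.mem_map.2 ⟨j, hj, rfl⟩)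
        (hrep j j.2) ?_ ?_
      · intro i hi
        obtain ⟨i, -, rfl⟩ := Finset.mem_map.1 hi
        exact (hI i i.2).2.trans (hI j j.2).2.symm
      · intro a i hi l hl
        obtain ⟨i, hiB, rfl⟩ := Finset.mem_map.1 hi
        obtain ⟨l, hlB, rfl⟩ := Finset.mem_map.1 hl
        cases a
        · exact (hB i hiB l hlB).1
        · exact (hB i hiB l hlB).2)
  refine ⟨k, by simpa using hk, ?_⟩
  have hF := card_perm_le_pow (R₁ := R .horizontal) (R₂ := R .vertical)
    (v₁ := fun i : I => (s i).coord .horizontal) (v₂ := fun i : I => (s i).coord .vertical)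
    ((hs .horizontal).comp Subtype.val_injective) ((hs .vertical).comp Subtype.val_injective)
    (fun i => ⟨g i, hg i (Finset.mem_univ i)⟩) (fun d => by simpa [Fin.ext_iff] using hch d)
    F (fun π hπ => hR π hπ _) (fun π hπ => hR π hπ _)
  simp only [Finset.card_univ, Fintype.card_perm, Fintype.card_coe] at hcard hF
  exact hcard.trans (Nat.mul_le_mul_left _ hF)

/-! ### From the two bounds to `m log n` -/

/-- The counting bound gives `m log m = O(t)`. -/
theorem mul_log_le_of_factorial_le {m k t : ℕ} (hm : 0 < m) (hmt : m ≤ t)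
    (hk : (k : ℝ) ≤ 4 * √(m : ℝ)) (h : m.factorial ≤ 2 ^ t * k ^ m) :
    m * Real.log m ≤ 8 * t := by
  have hm' : (0 : ℝ) < m := by exact_mod_cast hm
  have hmt' : (m : ℝ) ≤ t := by exact_mod_cast hmt
  have hf : (0 : ℝ) < m.factorial := by exact_mod_cast m.factorial_pos
  have hsq : 0 < √(m : ℝ) := Real.sqrt_pos.2 hm'
  have h1 : m * Real.log m - m ≤ Real.log m.factorial := by
    have := Real.pow_div_factorial_le_exp (m : ℝ) hm'.le m
    have := Real.log_le_log (by positivity) this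
    rw [Real.log_exp, Real.log_div (by positivity) hf.ne', Real.log_pow] at this
    linarith
  have h2 : (m.factorial : ℝ) ≤ 2 ^ t * (4 * √(m : ℝ)) ^ m := by
    calc (m.factorial : ℝ) ≤ 2 ^ t * (k : ℝ) ^ m := by exact_mod_cast h
      _ ≤ _ := by gcongr
  have h3 := Real.log_le_log hf h2
  rw [Real.log_mul (by positivity) (by positivity), Real.log_pow, Real.log_pow,
    Real.log_mul (by norm_num) hsq.ne', Real.log_sqrt hm'.le] at h3
  have h4 : Real.log 2 ≤ 1 := by linarith [Real.log_two_lt_d9]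
  have h5 : Real.log 4 ≤ 2 := by
    rw [show (4 : ℝ) = 2 ^ 2 by norm_num, Real.log_pow]
    push_cast
    linarith
  -- Together these give `(m / 2) log m ≤ t + 3m`, which is at most `4t` because `m ≤ t`.
  nlinarith [mul_le_mul_of_nonneg_left h4 (Nat.cast_nonneg (α := ℝ) t),
    mul_le_mul_of_nonneg_left h5 hm'.le]

/-- If `n ≤ m ^ 2`, then `log n ≤ 2 log m`. Otherwise `m ≤ √n` and `log n ≤ 2√n`, so the product is
at most `2n ≤ 22t`. -/
theorem mul_log_le_of_linear {m n t : ℕ} (hn : 0 < n) (hnt : n ≤ 11 * t)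
    (h : m * Real.log m ≤ 8 * t) : m * Real.log n ≤ 22 * t := by
  have hn' : (0 : ℝ) < n := by exact_mod_cast hn
  have hnt' : (n : ℝ) ≤ 11 * t := by exact_mod_cast hnt
  have ht : (0 : ℝ) ≤ t := Nat.cast_nonneg t
  rcases le_total n (m ^ 2) with hle | hle
  · have : Real.log n ≤ 2 * Real.log m := by
      have := Real.log_le_log hn' (show (n : ℝ) ≤ (m : ℝ) ^ 2 by exact_mod_cast hle)
      rw [Real.log_pow] at this
      exact_mod_cast this
    nlinarith [mul_le_mul_of_nonneg_left this (Nat.cast_nonneg (α := ℝ) m)]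
  · have hsq : 0 < √(n : ℝ) := Real.sqrt_pos.2 hn'
    have h1 : (m : ℝ) ≤ √(n : ℝ) := Real.le_sqrt_of_sq_le (by exact_mod_cast hle)
    have h2 : Real.log n ≤ 2 * √(n : ℝ) := by
      have := Real.log_le_sub_one_of_pos hsq
      rw [Real.log_sqrt hn'.le] at this
      linarith
    have h3 : 0 ≤ Real.log n := Real.log_natCast_nonneg n
    have h4 := Real.mul_self_sqrt hn'.le
    nlinarith [mul_le_mul h1 h2 h3 hsq.le]

/-! ### Both colours participate; the main theorem -/

/-- A point that sees a participating point of the opposite colour participates. -/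
theorem exists_participating_of_color {S : Set ColoredPoint} {p : ColoredPoint}
    (hp : p ∈ participating S) (κ : Color) : ∃ q ∈ participating S, q.color = κ := by
  obtain ⟨hpS, q, hqS, hqc, hq⟩ := id hp
  by_cases h : p.color = κ
  · exact ⟨p, hp, h⟩
  · refine ⟨q, ⟨hqS, p, hpS, hqc.symm, fun r hr => ?_⟩, ?_⟩
    · rw [Set.uIoo_comm p.x, Set.uIoo_comm p.y]
      exact hq r hr
    · rcases hc : q.color with _ | _ <;> rcases hc' : p.color with _ | _ <;> rcases κ with _ | _ <;>
        simp_all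

end OrderOblivious

open OrderOblivious in
theorem mainTheorem10 :
    ∃ c : ℝ, 0 < c ∧ ∀ S : Finset OrderOblivious.ColoredPoint,
      OrderOblivious.Nondegenerate (S : Set OrderOblivious.ColoredPoint) →
        c * (((OrderOblivious.participating (S : Set OrderOblivious.ColoredPoint)).ncard : ℝ) *
            Real.log (S.card : ℝ)) ≤
          (OrderOblivious.OPT S : ℝ) := by
  classical
  -- Each colour contributes at most `22 * t`.
  refine ⟨1 / 44, by norm_num, fun S hS => ?_⟩
  obtain ⟨A, hA, hAt⟩ := exists_correct_worstTime_eq_OPT S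
  rw [← hAt]
  set t := A.worstTime S
  obtain ⟨σ⟩ : Nonempty (Fin S.card ≃ {p // p ∈ S}) := ⟨S.equivFin.symm⟩
  let s : Fin S.card → ColoredPoint := fun i => σ i
  let c : Fin S.card → Color := fun i => (s i).color
  let T : DecisionTree S.card := A S.card c
  have hrange : Set.range s = S := by
    ext p
    constructor
    · rintro ⟨i, rfl⟩
      exact (σ i).2
    · intro hp
      exact ⟨σ.symm ⟨p, hp⟩, by simp [s]⟩
  have hsinj : Function.Injective s := Subtype.val_injective.comp σ.injective
  have hs : Generic s := by
    intro a i j hij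
    cases a
    · exact hsinj (hS.1 (σ i).2 (σ j).2 hij)
    · exact hsinj (hS.2 (σ i).2 (σ j).2 hij)
  have hT : T.CorrectFor c := by
    intro s' hs' hc'
    have := hA S.card s' (hs' .horizontal) (hs' .vertical)
    rwa [Algorithm.tree, funext hc'] at this
  -- Only colour-preserving reorderings are used: another colouring of the indices may be assigned
  -- an unrelated tree.
  have htime : ∀ τ : Equiv.Perm (Fin S.card), (∀ i, (s (τ i)).color = c i) →
      T.time (s ∘ τ) ≤ t := by
    intro τ hτ
    have := Finset.le_sup (f := fun σ : Fin S.card ≃ {p // p ∈ S} =>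
      (A.tree fun i => (σ i : ColoredPoint)).time fun i => (σ i : ColoredPoint))
      (Finset.mem_univ (τ.trans σ))
    have e : (fun i => ((τ.trans σ i : {p // p ∈ S}) : ColoredPoint)) = s ∘ τ := rfl
    simp only [e] at this
    rwa [Algorithm.tree, show (fun i => ((s ∘ τ) i).color) = c from funext hτ] at this
  have hts : T.time s ≤ t := htime (Equiv.refl _) fun _ => rfl
  have hout : T.output s = s ⁻¹' participating (S : Set ColoredPoint) := by
    rw [hT s hs fun _ => rfl, hrange]
    rfl
  have hpart : participating (S : Set ColoredPoint) = s '' T.output s := by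
    rw [hout, Set.image_preimage_eq_of_subset]
    rw [hrange]
    exact fun p hp => hp.1
  have hncard : (participating (S : Set ColoredPoint)).ncard = (T.output s).ncard := by
    rw [hpart, Set.ncard_image_of_injective _ hsinj]
  rw [hncard]
  rcases Set.eq_empty_or_nonempty (T.output s) with h0 | ⟨j, hj⟩
  · simp [h0]
  have hcol : ∀ κ, ∃ j ∈ T.output s, c j = κ := by
    intro κ
    obtain ⟨q, hq, hqκ⟩ := exists_participating_of_color (show s j ∈ participating _ by
      rw [hpart]; exact ⟨j, hj, rfl⟩) κ
    rw [hpart] at hq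
    obtain ⟨i, hi, rfl⟩ := hq
    exact ⟨i, hi, hqκ⟩
  have hht := (T.ncard_output_le_time s).trans hts
  have hhpos : 0 < (T.output s).ncard := (Set.ncard_pos (Set.toFinite _)).2 ⟨j, hj⟩
  -- Something is reported, so `t ≥ 1` and the additive 8 is absorbed.
  have hn : S.card ≤ 11 * t := by
    have := hT.le_time hs hcol
    omega
  have hnpos : 0 < S.card := Fin.pos j
  let O : Color → Finset (Fin S.card) := fun κ => Finset.univ.filter fun i => i ∈ T.output s ∧ c i = κ
  have hmono : ∀ κ, ((O κ).card : ℝ) * Real.log S.card ≤ 22 * t := by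
    intro κ
    obtain ⟨k, hk, hf⟩ := hT.factorial_le hs (fun _ => rfl) (κ := κ) (O κ)
      (fun i hi => (Finset.mem_filter.1 hi).2) htime
    have hpos : 0 < (O κ).card := by
      obtain ⟨i, hi, hκ⟩ := hcol κ
      exact Finset.card_pos.2 ⟨i, by simp [O, hi, hκ]⟩
    have hle : (O κ).card ≤ t := by
      refine le_trans ?_ hht
      rw [← Set.ncard_coe_finset]
      exact Set.ncard_le_ncard fun i hi => (Finset.mem_filter.1 hi).2.1
    exact mul_log_le_of_linear hnpos hn (mul_log_le_of_factorial_le hpos hle hk hf)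
  have hunion : (T.output s).ncard ≤ (O .red).card + (O .blue).card := by
    refine le_trans ?_ (Finset.card_union_le _ _)
    rw [← Set.ncard_coe_finset (O .red ∪ O .blue)]
    refine Set.ncard_le_ncard fun i hi => ?_
    rcases hci : c i with _ | _ <;> simp [O, hi, hci]
  have hunion' : ((T.output s).ncard : ℝ) ≤ (O .red).card + (O .blue).card := by
    exact_mod_cast hunion
  have hlog : 0 ≤ Real.log (S.card : ℝ) := Real.log_natCast_nonneg _
  nlinarith [hmono .red, hmono .blue, mul_le_mul_of_nonneg_right hunion' hlog]
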